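/- For an even integer $n$ and an integer $k$ with $0\le k<n/2$, let $g_n^k$ be the partial Boolean function on $\{0,1\}^n$ with $g_n^k(x)=0$ if the Hamming weight $|x|$ is in $\{k,n-k\}$, $g_n^k(x)=1$ if $|x|=n/2$, and $g_n^k(x)$ undefined otherwise. Let $Q_E(f)$ denote the exact quantum query complexity of a partial Boolean function $f$: the minimum number of uses of the oracle $O_x$, where $O_x|0\rangle=|0\rangle$ and $O_x|i\rangle=(-1)^{x_i}|i\rangle$ for $1\le i\le n$, made by a quantum algorithm (input-independent unitaries interleaved with oracle calls, with an arbitrary finite-dimensional workspace and a final measurement) that outputs $f(x)$ with probability $1$ on every input $x$ at which $f$ is defined. (1) For every even $n\ge 2$, $Q_E(g_n^0)=1$. (2) Let $d>1$ be an integer and let $$\tfrac12\Bigl(1-\cos\tfrac{(d-2)\pi}{2(d-1)}\Bigr)<\kappa_0\le \tfrac12\Bigl(1-\cos\tfrac{(d-1)\pi}{2d}\Bigr).$$ Then there is an $N$, depending only on $d$ and $\kappa_0$, such that $Q_E(g_n^k)=d$ for all even $n\ge N$ and all integers $k$ with $$\kappa_0\le\frac kn\le \tfrac12\Bigl(1-\cos\tfrac{(d-1)\pi}{2d}\Bigr).$$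 In particular, for every fixed ratio $\kappa=k/n$ with $\frac12(1-\cos\frac{(d-2)\pi}{2(d-1)})<\kappa\le\frac12(1-\cos\frac{(d-1)\pi}{2d})$, one has $Q_E(g_n^k)=d$ for all sufficiently large even $n$ with $k=\kappa n$ an integer. -/

import Mathlib

/-- The Hamming weight `|x|` of a bit string `x ∈ {0,1}ⁿ` (`true` is the bit `1`). -/
def hammingWeight {n : ℕ} (x : Fin n → Bool) : ℕ :=
  (Finset.univ.filter fun i => x i = true).card

/-- A partial Boolean function on `{0,1}ⁿ`; the value `none` means undefined. -/
abbrev PartialBoolFun (n : ℕ) : Type := (Fin n → Bool) → Option Bool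

/-- The basis states `|i⟩|w⟩`: the query register holds an index `i ∈ {0, 1, …, n}`
(`none` is the index `0`, which the oracle does not touch, and `some i` is the `i`-th input
position), and the workspace register has dimension `m + 1`. -/
abbrev QueryBasis (n m : ℕ) : Type := Option (Fin n) × Fin (m + 1)

/-- The phase oracle `O_x`: `|0⟩|w⟩ ↦ |0⟩|w⟩` and `|i⟩|w⟩ ↦ (-1)^{x_i} |i⟩|w⟩` for `i ∈ [n]`. -/
def phaseOracle {n : ℕ} (m : ℕ) (x : Fin n → Bool) :
    Matrix (QueryBasis n m) (QueryBasis n m) ℂ :=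
  Matrix.diagonal fun s =>
    match s.1 with
    | none => 1
    | some i => if x i = true then -1 else 1

/-- A quantum query algorithm on `n`-bit inputs. It starts in the basis state `|0⟩|0⟩` and applies
`U 0, O_x, U 1, O_x, …, O_x, U T`, where `T = queries`; then it measures in the standard basis
and outputs the bit `out s` if the outcome is `s`. (`U t` for `t > T` is never used. The unitaries
and the finite-dimensional workspace are arbitrary, so by deferring measurements
this covers algorithms that measure between queries.) -/
structure QuantumQueryAlgorithm (n : ℕ) where
  queries : ℕ
  workspace : ℕ
  U : ℕ → Matrix.unitaryGroup (QueryBasis n workspace) ℂ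
  out : QueryBasis n workspace → Bool

namespace QuantumQueryAlgorithm

/-- The state on input `x` after `t` queries and the unitary `U t` that follows them. -/
def stateAfter {n : ℕ} (A : QuantumQueryAlgorithm n) (x : Fin n → Bool) :
    ℕ → QueryBasis n A.workspace → ℂ
  | 0 => Matrix.mulVec (A.U 0 : Matrix (QueryBasis n A.workspace) (QueryBasis n A.workspace) ℂ)
      (Pi.single (none, 0) 1)
  | t + 1 =>
      Matrix.mulVec (A.U (t + 1) : Matrix (QueryBasis n A.workspace) (QueryBasis n A.workspace) ℂ)
        (Matrix.mulVec (phaseOracle A.workspace x) (A.stateAfter x t))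

/-- The probability that the algorithm outputs the bit `b` on input `x`. -/
noncomputable def outputProb {n : ℕ} (A : QuantumQueryAlgorithm n) (x : Fin n → Bool)
    (b : Bool) : ℝ :=
  ∑ s ∈ Finset.univ.filter (fun s => A.out s = b), ‖A.stateAfter x A.queries s‖ ^ 2

/-- `A` computes `f` exactly: on every input where `f` is defined, it outputs the value of `f`
with probability `1`. -/
def ComputesExactly {n : ℕ} (A : QuantumQueryAlgorithm n) (f : PartialBoolFun n) : Prop :=
  ∀ (x : Fin n → Bool) (b : Bool), f x = some b → A.outputProb x b = 1

end QuantumQueryAlgorithm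

/-- The exact quantum query complexity `Q_E(f)`: the least number of queries of a quantum query
algorithm that computes `f` exactly (`⊤` if there were none). -/
noncomputable def exactQuantumQueryComplexity {n : ℕ} (f : PartialBoolFun n) : ℕ∞ :=
  ⨅ (A : QuantumQueryAlgorithm n) (_ : A.ComputesExactly f), (A.queries : ℕ∞)

/-- The partial function `g_n^k`: it is `0` if `|x| ∈ {k, n - k}`, it is `1` if `|x| = n / 2`
(in particular `n` must be even for this case to occur), and it is undefined otherwise. -/
def gFun (n k : ℕ) : PartialBoolFun n := fun x =>
  if hammingWeight x = k ∨ hammingWeight x + k = n then some false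
  else if 2 * hammingWeight x = n then some true
  else none

/-! Both bounds come from Chebyshev polynomials. Put `n = 2h` and `y = 1 - k/h`. Since `cos
((d-1)π/(2d)) = sin (π/(2d))`, the upper bound on `k/n` says `y ≥ sin (π/(2d))`, while `κ₀` keeps
`y` at most a constant strictly below `sin (π/(2(d-1)))`.

Lower bound: averaging the acceptance probability of an `m`-query algorithm over each weight layer
gives a polynomial of degree at most `2m` in the weight, with values in `[0,1]` at the integers `0,
…, 2h`. Its even part about `h` is a polynomial `S` of degree at most `m` in the squared relative
distance from the middle, with `S(0) = 1` and `S(y²) = 0`. So `2S - 1` falls from `1` to `-1` on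
`[0, y²]`, while `T_m(1 - 2z)` first reaches `-1` at `z = sin² (π/(2m))`. A divided difference at
`0`, `y²` and `m` grid points close to the Chebyshev extrema (`comparison_polynomial_le`) rules this
out. Boundedness is known only on the grid, so `h` must be large (`eventually_grid_nodes`).

Upper bound: alternating the oracle with a fixed reflection produces, after `d` queries, the
amplitude `T_d(a)` with `a = (1-b)(1 - 2|x|/n)` (`exists_algorithm_chebyshev`). Choosing `b` so that
`a = ± sin (π/(2d))` on the outer layers makes `T_d(a)²` equal to `0` on one side of the promise and
`1` on the other. For `k = 0` one query suffices, and zero queries give a constant polynomial. -/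

/-! ### Amplitudes and output probabilities as low-degree polynomials -/

/-- The indicator of the event that all the bits in `S` are `1`. -/
def bitMonomial {n : ℕ} (S : Finset (Fin n)) (x : Fin n → Bool) : ℝ :=
  if ∀ i ∈ S, x i = true then 1 else 0

/-- The real functions on the cube that are polynomials of degree at most `t` in the bits. -/
def lowDegree (n t : ℕ) : Submodule ℝ ((Fin n → Bool) → ℝ) :=
  Submodule.span ℝ (bitMonomial '' {S | S.card ≤ t})

lemma bitMonomial_mul {n : ℕ} (S T : Finset (Fin n)) :
    bitMonomial S * bitMonomial T = bitMonomial (S ∪ T) := by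
  funext x
  simp only [Pi.mul_apply, bitMonomial, Finset.mem_union]
  grind

lemma bitMonomial_mem_lowDegree {n t : ℕ} {S : Finset (Fin n)} (h : S.card ≤ t) :
    bitMonomial S ∈ lowDegree n t :=
  Submodule.subset_span ⟨S, h, rfl⟩

lemma lowDegree_mono {n s t : ℕ} (h : s ≤ t) : lowDegree n s ≤ lowDegree n t :=
  Submodule.span_mono (Set.image_mono fun _ hS => le_trans hS h)

lemma const_mem_lowDegree {n : ℕ} (t : ℕ) (c : ℝ) : (fun _ => c) ∈ lowDegree n t := by
  have h := (lowDegree n t).smul_mem c (bitMonomial_mem_lowDegree (S := ∅) (by simp))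
  convert h using 1
  funext x
  simp [bitMonomial]

lemma mul_mem_lowDegree {n s t : ℕ} {f g : (Fin n → Bool) → ℝ} (hf : f ∈ lowDegree n s)
    (hg : g ∈ lowDegree n t) : f * g ∈ lowDegree n (s + t) := by
  have h := Submodule.mul_mem_mul hf hg
  rw [lowDegree, lowDegree, Submodule.span_mul_span] at h
  refine Submodule.span_le.2 ?_ h
  rintro _ ⟨_, ⟨S, hS, rfl⟩, _, ⟨T, hT, rfl⟩, rfl⟩
  simp only [bitMonomial_mul]
  exact bitMonomial_mem_lowDegree ((Finset.card_union_le S T).trans (add_le_add hS hT))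

lemma sign_mem_lowDegree {n : ℕ} (i : Fin n) :
    (fun x : Fin n → Bool => if x i = true then (-1 : ℝ) else 1) ∈ lowDegree n 1 := by
  have h := (lowDegree n 1).sub_mem (const_mem_lowDegree 1 1)
    ((lowDegree n 1).smul_mem 2 (bitMonomial_mem_lowDegree (S := {i}) (by simp)))
  convert h using 1
  funext x
  by_cases hx : x i = true <;> simp [bitMonomial, hx]
  norm_num

lemma mulVec_mem_lowDegree {n t : ℕ} {ι : Type*} [Fintype ι] (M : Matrix ι ι ℂ)
    {ψ : (Fin n → Bool) → ι → ℂ}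
    (hψ : ∀ s, (fun x => (ψ x s).re) ∈ lowDegree n t ∧ (fun x => (ψ x s).im) ∈ lowDegree n t)
    (s : ι) : (fun x => (M.mulVec (ψ x) s).re) ∈ lowDegree n t ∧
      (fun x => (M.mulVec (ψ x) s).im) ∈ lowDegree n t := by
  have hre : (fun x => (M.mulVec (ψ x) s).re) = ∑ r, ((M s r).re • (fun x => (ψ x r).re) -
      (M s r).im • (fun x => (ψ x r).im)) := by
    funext x
    simp [Matrix.mulVec, dotProduct, Finset.sum_apply]
  have him : (fun x => (M.mulVec (ψ x) s).im) = ∑ r, ((M s r).re • (fun x => (ψ x r).im) +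
      (M s r).im • (fun x => (ψ x r).re)) := by
    funext x
    simp [Matrix.mulVec, dotProduct, Finset.sum_apply]
  rw [hre, him]
  exact ⟨sum_mem fun r _ => sub_mem (Submodule.smul_mem _ _ (hψ r).1)
      (Submodule.smul_mem _ _ (hψ r).2),
    sum_mem fun r _ => add_mem (Submodule.smul_mem _ _ (hψ r).2)
      (Submodule.smul_mem _ _ (hψ r).1)⟩

lemma phaseOracle_mulVec {n m : ℕ} (x : Fin n → Bool) (ψ : QueryBasis n m → ℂ)
    (s : QueryBasis n m) : (phaseOracle m x).mulVec ψ s =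
      (match s.1 with | none => (1 : ℝ) | some i => if x i = true then -1 else 1 : ℝ) * ψ s := by
  rw [phaseOracle, Matrix.mulVec_diagonal]
  rcases s with ⟨_ | i, w⟩
  · simp
  · by_cases hx : x i = true <;> simp [hx]

lemma phaseOracle_mem_lowDegree {n t m : ℕ} {ψ : (Fin n → Bool) → QueryBasis n m → ℂ}
    (hψ : ∀ s, (fun x => (ψ x s).re) ∈ lowDegree n t ∧ (fun x => (ψ x s).im) ∈ lowDegree n t)
    (s : QueryBasis n m) :
    (fun x => ((phaseOracle m x).mulVec (ψ x) s).re) ∈ lowDegree n (t + 1) ∧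
      (fun x => ((phaseOracle m x).mulVec (ψ x) s).im) ∈ lowDegree n (t + 1) := by
  simp only [phaseOracle_mulVec, Complex.re_ofReal_mul, Complex.im_ofReal_mul]
  rcases s with ⟨_ | i, w⟩
  · simp only [one_mul]
    exact ⟨lowDegree_mono t.le_succ (hψ _).1, lowDegree_mono t.le_succ (hψ _).2⟩
  · rw [add_comm t]
    exact ⟨mul_mem_lowDegree (sign_mem_lowDegree i) (hψ _).1,
      mul_mem_lowDegree (sign_mem_lowDegree i) (hψ _).2⟩

namespace QuantumQueryAlgorithm

/-- Only the oracle depends on `x`, and it multiplies each amplitude by `1` or `1 - 2 xᵢ`; the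
unitaries take constant linear combinations. So each query costs one degree. -/
lemma stateAfter_mem_lowDegree {n : ℕ} (A : QuantumQueryAlgorithm n) (t : ℕ) :
    ∀ s, (fun x => (A.stateAfter x t s).re) ∈ lowDegree n t ∧
      (fun x => (A.stateAfter x t s).im) ∈ lowDegree n t := by
  induction t with
  | zero =>
    intro s
    simp only [stateAfter]
    exact ⟨const_mem_lowDegree 0 _, const_mem_lowDegree 0 _⟩
  | succ t ih => exact mulVec_mem_lowDegree _ (phaseOracle_mem_lowDegree ih)

lemma outputProb_mem_lowDegree {n : ℕ} (A : QuantumQueryAlgorithm n) (b : Bool) :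
    (fun x => A.outputProb x b) ∈ lowDegree n (2 * A.queries) := by
  have h : (fun x => A.outputProb x b) = ∑ s ∈ Finset.univ.filter (fun s => A.out s = b),
      ((fun x => (A.stateAfter x A.queries s).re) * (fun x => (A.stateAfter x A.queries s).re) +
      (fun x => (A.stateAfter x A.queries s).im) *
        (fun x => (A.stateAfter x A.queries s).im)) := by
    funext x
    simp [outputProb, Finset.sum_apply, Complex.sq_norm, Complex.normSq_apply]
  rw [h, two_mul]
  exact sum_mem fun s _ => add_mem
    (mul_mem_lowDegree (A.stateAfter_mem_lowDegree _ s).1 (A.stateAfter_mem_lowDegree _ s).1)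
    (mul_mem_lowDegree (A.stateAfter_mem_lowDegree _ s).2 (A.stateAfter_mem_lowDegree _ s).2)

lemma sum_norm_sq_mulVec_unitary {ι : Type*} [Fintype ι] [DecidableEq ι]
    (V : Matrix.unitaryGroup ι ℂ) (ψ : ι → ℂ) :
    ∑ s, ‖(V : Matrix ι ι ℂ).mulVec ψ s‖ ^ 2 = ∑ s, ‖ψ s‖ ^ 2 := by
  have key : ∀ φ : ι → ℂ, ((∑ s, ‖φ s‖ ^ 2 : ℝ) : ℂ) = star φ ⬝ᵥ φ := by
    intro φ
    simp [dotProduct, ← Complex.conj_mul']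
  apply Complex.ofReal_injective
  rw [key, key, Matrix.star_mulVec, Matrix.dotProduct_mulVec, Matrix.vecMul_vecMul,
    ← Matrix.star_eq_conjTranspose, Matrix.mem_unitaryGroup_iff'.1 V.2, Matrix.vecMul_one]

lemma sum_norm_sq_stateAfter {n : ℕ} (A : QuantumQueryAlgorithm n) (x : Fin n → Bool) (t : ℕ) :
    ∑ s, ‖A.stateAfter x t s‖ ^ 2 = 1 := by
  induction t with
  | zero =>
    rw [stateAfter, sum_norm_sq_mulVec_unitary, Finset.sum_eq_single (none, 0)]
    · simp
    · intro s _ hs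
      simp [hs]
    · simp
  | succ t ih =>
    rw [stateAfter, sum_norm_sq_mulVec_unitary, ← ih]
    refine Finset.sum_congr rfl fun s _ => ?_
    rw [phaseOracle_mulVec, norm_mul, Complex.norm_real, mul_pow]
    rcases s with ⟨_ | i, w⟩
    · simp
    · by_cases hx : x i = true <;> simp [hx]

lemma outputProb_add_outputProb {n : ℕ} (A : QuantumQueryAlgorithm n) (x : Fin n → Bool) :
    A.outputProb x true + A.outputProb x false = 1 := by
  rw [← A.sum_norm_sq_stateAfter x A.queries, outputProb, outputProb,
    ← Finset.sum_filter_add_sum_filter_not Finset.univ (fun s => A.out s = true)]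
  simp

lemma outputProb_nonneg {n : ℕ} (A : QuantumQueryAlgorithm n) (x : Fin n → Bool) (b : Bool) :
    0 ≤ A.outputProb x b :=
  Finset.sum_nonneg fun _ _ => by positivity

end QuantumQueryAlgorithm

/-! ### Symmetrization over weight layers -/

/-- The bit strings of Hamming weight `w`. -/
def weightLayer (n w : ℕ) : Finset (Fin n → Bool) :=
  Finset.univ.filter fun x => hammingWeight x = w

lemma mem_weightLayer {n w : ℕ} {x : Fin n → Bool} :
    x ∈ weightLayer n w ↔ hammingWeight x = w := by
  simp [weightLayer]

lemma card_weightLayer_filter {n : ℕ} (w : ℕ) (S : Finset (Fin n)) :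
    ((weightLayer n w).filter fun x => ∀ i ∈ S, x i = true).card =
      (((Finset.univ : Finset (Fin n)).powersetCard w).filter fun T => S ⊆ T).card := by
  refine Finset.card_nbij' (fun x => Finset.univ.filter fun i => x i = true)
    (fun T i => decide (i ∈ T)) ?_ ?_ ?_ ?_
  · intro x hx
    simp only [Finset.mem_coe, Finset.mem_filter, mem_weightLayer, hammingWeight, true_and,
      Finset.mem_powersetCard, Finset.subset_univ] at hx ⊢
    exact ⟨hx.1, fun i hi => by simpa using hx.2 i hi⟩
  · intro T hT
    simp only [Finset.mem_coe, Finset.mem_filter, mem_weightLayer, hammingWeight, true_and,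
      Finset.mem_powersetCard, Finset.subset_univ,
      decide_eq_true_eq, Finset.filter_univ_mem] at hT ⊢
    exact ⟨hT.1, hT.2⟩
  · intro x _
    simp
  · intro T _
    simp

lemma card_powersetCard_filter_superset {α : Type*} [DecidableEq α] [Fintype α] (w : ℕ)
    (S : Finset α) (h : S.card ≤ w) :
    (((Finset.univ : Finset α).powersetCard w).filter fun T => S ⊆ T).card =
      (Fintype.card α - S.card).choose (w - S.card) := by
  rw [← Finset.card_compl, ← Finset.card_powersetCard]
  refine Finset.card_nbij' (fun T => T \ S) (fun T => T ∪ S) ?_ ?_ ?_ ?_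
  · intro T hT
    simp only [Finset.mem_coe, Finset.mem_filter, Finset.mem_powersetCard,
      Finset.subset_univ, true_and] at hT ⊢
    refine ⟨fun i hi => by simp at hi ⊢; exact hi.2, ?_⟩
    rw [Finset.card_sdiff_of_subset hT.2, hT.1]
  · intro T hT
    simp only [Finset.mem_coe, Finset.mem_filter, Finset.mem_powersetCard,
      Finset.subset_univ, true_and] at hT ⊢
    refine ⟨?_, Finset.subset_union_right⟩
    rw [Finset.card_union_of_disjoint, hT.2]
    · omega
    · exact (Finset.subset_compl_iff_disjoint_right).1 hT.1
  · intro T hT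
    simp only [Finset.mem_coe, Finset.mem_filter] at hT
    exact Finset.sdiff_union_of_subset hT.2
  · intro T hT
    simp only [Finset.mem_coe, Finset.mem_powersetCard] at hT
    exact Finset.union_sdiff_cancel_right ((Finset.subset_compl_iff_disjoint_right).1 hT.1)

lemma card_weightLayer (n w : ℕ) : (weightLayer n w).card = n.choose w := by
  have h := card_weightLayer_filter w (∅ : Finset (Fin n))
  rw [card_powersetCard_filter_superset w ∅ (by simp)] at h
  simpa using h

/-- Counting pairs of nested subsets in two ways shows that the layer average of a monomial is
`w.choose s / n.choose s` with `s = S.card`, a polynomial of degree `s` in `w`. The cleared form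
also covers `w < s`, where both sides vanish. -/
lemma sum_weightLayer_bitMonomial {n : ℕ} (w : ℕ) (S : Finset (Fin n)) :
    (∑ x ∈ weightLayer n w, bitMonomial S x) * n.choose S.card =
      n.choose w * w.choose S.card := by
  simp only [bitMonomial, Finset.sum_boole, card_weightLayer_filter]
  by_cases h : S.card ≤ w
  · rw [card_powersetCard_filter_superset w S h]
    have := Nat.choose_mul (n := n) h
    rw [Fintype.card_fin]
    rw [mul_comm]
    exact_mod_cast this.symm
  · rw [Nat.choose_eq_zero_of_lt (not_le.1 h), Finset.filter_false_of_mem]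
    · simp
    · intro T hT hS
      rw [Finset.mem_powersetCard] at hT
      exact h (hT.2 ▸ Finset.card_le_card hS)

lemma exists_polynomial_eval_eq_choose (s : ℕ) :
    ∃ P : Polynomial ℝ, P.natDegree ≤ s ∧ ∀ w : ℕ, P.eval (w : ℝ) = w.choose s := by
  refine ⟨Polynomial.C ((s.factorial : ℝ)⁻¹) * descPochhammer ℝ s, ?_, fun w => ?_⟩
  · refine (Polynomial.natDegree_C_mul_le _ _).trans ?_
    rw [descPochhammer_natDegree]
  · rw [Polynomial.eval_mul, Polynomial.eval_C, descPochhammer_eval_eq_descFactorial,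
      Nat.descFactorial_eq_factorial_mul_choose]
    push_cast
    field_simp

/-- Symmetrization: the sum over a layer of a polynomial of degree `t` is, up to the size of the
layer, a polynomial of degree at most `t` in the Hamming weight. -/
lemma exists_polynomial_sum_weightLayer {n t : ℕ} {f : (Fin n → Bool) → ℝ}
    (hf : f ∈ lowDegree n t) : ∃ P : Polynomial ℝ, P.natDegree ≤ t ∧
      ∀ w : ℕ, ∑ x ∈ weightLayer n w, f x = n.choose w * P.eval (w : ℝ) := by
  induction hf using Submodule.span_induction with
  | mem g hg =>
    obtain ⟨S, hS, rfl⟩ := hg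
    obtain ⟨P, hP, hw⟩ := exists_polynomial_eval_eq_choose S.card
    refine ⟨Polynomial.C ((n.choose S.card : ℝ)⁻¹) * P,
      (Polynomial.natDegree_C_mul_le _ _).trans (hP.trans hS), fun w => ?_⟩
    have hpos : (n.choose S.card : ℝ) ≠ 0 := by
      have : S.card ≤ n := by simpa using S.card_le_univ
      exact_mod_cast (Nat.choose_pos this).ne'
    rw [Polynomial.eval_mul, Polynomial.eval_C, hw]
    field_simp
    exact sum_weightLayer_bitMonomial w S
  | zero => exact ⟨0, by simp, by simp⟩
  | add f g _ _ hf hg =>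
    obtain ⟨P, hP, hw⟩ := hf
    obtain ⟨Q, hQ, hv⟩ := hg
    refine ⟨P + Q, (Polynomial.natDegree_add_le _ _).trans (max_le hP hQ), fun w => ?_⟩
    simp only [Pi.add_apply, Finset.sum_add_distrib, hw, hv, Polynomial.eval_add, mul_add]
  | smul c f _ hf =>
    obtain ⟨P, hP, hw⟩ := hf
    refine ⟨Polynomial.C c * P, (Polynomial.natDegree_C_mul_le _ _).trans hP, fun w => ?_⟩
    simp only [Pi.smul_apply, smul_eq_mul, ← Finset.mul_sum, hw, Polynomial.eval_mul,
      Polynomial.eval_C]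
    ring

/-- The polynomial method for the functions `g_n^k`. -/
lemma exists_polynomial_of_computesExactly {h k : ℕ} (hk : k < h)
    {A : QuantumQueryAlgorithm (2 * h)} (hA : A.ComputesExactly (gFun (2 * h) k)) :
    ∃ P : Polynomial ℝ, P.natDegree ≤ 2 * A.queries ∧
      (∀ w : ℕ, w ≤ 2 * h → 0 ≤ P.eval (w : ℝ) ∧ P.eval (w : ℝ) ≤ 1) ∧
      P.eval (h : ℝ) = 1 ∧ P.eval (k : ℝ) = 0 ∧ P.eval ((2 * h - k : ℕ) : ℝ) = 0 := by
  obtain ⟨P, hP, hw⟩ := exists_polynomial_sum_weightLayer (A.outputProb_mem_lowDegree true)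
  have hpos : ∀ w : ℕ, w ≤ 2 * h → (0 : ℝ) < ((2 * h).choose w : ℕ) := fun w hwn => by
    exact_mod_cast Nat.choose_pos hwn
  have const : ∀ (w : ℕ) (c : ℝ), w ≤ 2 * h →
      (∀ x, hammingWeight x = w → A.outputProb x true = c) → P.eval (w : ℝ) = c := by
    intro w c hwn hc
    have h1 := hw w
    rw [Finset.sum_congr rfl fun x hx => hc x (mem_weightLayer.1 hx),
      Finset.sum_const, card_weightLayer, nsmul_eq_mul] at h1
    exact (mul_left_cancel₀ (hpos w hwn).ne' h1).symm
  have zero : ∀ x : Fin (2 * h) → Bool, gFun (2 * h) k x = some false →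
      A.outputProb x true = 0 := fun x hx => by
    linarith [A.outputProb_add_outputProb x, hA x false hx]
  refine ⟨P, hP, fun w hwn => ⟨?_, ?_⟩, const h 1 (by omega) fun x hx => hA x true ?_,
    const k 0 (by omega) fun x hx => zero x ?_, const _ 0 (by omega) fun x hx => zero x ?_⟩
  · refine nonneg_of_mul_nonneg_right ?_ (hpos w hwn)
    rw [← hw w]
    exact Finset.sum_nonneg fun x _ => A.outputProb_nonneg x true
  · refine le_of_mul_le_mul_left ?_ (hpos w hwn)
    rw [← hw w, mul_one, ← card_weightLayer, ← nsmul_one, ← Finset.sum_const]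
    exact Finset.sum_le_sum fun x _ => by
      linarith [A.outputProb_add_outputProb x, A.outputProb_nonneg x false]
  · simp only [gFun, hx]
    rw [if_neg (by omega), if_pos trivial]
  · simp [gFun, hx]
  · simp only [gFun, hx]
    rw [if_pos (by omega)]

/-! ### Chebyshev extremality via divided differences -/

open Polynomial in
/-- The divided difference at `m + 2` increasing nodes kills polynomials of degree at most `m`,
and its coefficients alternate in sign. -/
lemma exists_alternating_weights {m : ℕ} {v : ℕ → ℝ}
    (hv : ∀ i j, i < j → j < m + 2 → v i < v j) :
    ∃ a : ℕ → ℝ, (∀ i < m + 2, 0 < a i) ∧ ∀ P : ℝ[X], P.natDegree ≤ m →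
      ∑ i ∈ Finset.range (m + 2), (-1) ^ i * a i * P.eval (v i) = 0 := by
  classical
  set W : ℕ → ℝ := fun i => ∏ j ∈ (Finset.range (m + 2)).erase i, (v i - v j) with hW
  -- Exactly the `m + 1 - i` nodes to the right of `v i` contribute negative factors.
  have hsign : ∀ i < m + 2, 0 < (-1) ^ (m + 1 - i) * W i := by
    intro i hi
    have hsplit : (Finset.range (m + 2)).erase i =
        Finset.range i ∪ Finset.Ioo i (m + 2) := by
      ext j
      simp only [Finset.mem_erase, Finset.mem_range, Finset.mem_union, Finset.mem_Ioo]
      omega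
    have hdisj : Disjoint (Finset.range i) (Finset.Ioo i (m + 2)) := by
      rw [Finset.disjoint_left]
      intro j
      simp only [Finset.mem_range, Finset.mem_Ioo]
      omega
    have hcard : (Finset.Ioo i (m + 2)).card = m + 1 - i := by
      rw [Nat.card_Ioo]
      omega
    simp only [hW]
    rw [hsplit, Finset.prod_union hdisj, mul_left_comm, ← hcard, ← Finset.prod_const,
      ← Finset.prod_mul_distrib]
    refine mul_pos (Finset.prod_pos fun j hj => ?_) (Finset.prod_pos fun j hj => ?_)
    · linarith [hv j i (Finset.mem_range.1 hj) hi]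
    · rw [Finset.mem_Ioo] at hj
      linarith [hv i j hj.1 hj.2]
  refine ⟨fun i => ((-1) ^ (m + 1 - i) * W i)⁻¹, fun i hi => inv_pos.2 (hsign i hi),
    fun P hP => ?_⟩
  have hinj : Set.InjOn v (Finset.range (m + 2)) := by
    intro i hi j hj hij
    simp only [Finset.coe_range, Set.mem_Iio] at hi hj
    rcases lt_trichotomy i j with h | h | h
    · exact absurd hij (hv i j h hj).ne
    · exact h
    · exact absurd hij (hv j i h hi).ne'
  -- The divided difference is the coefficient of degree `m + 1` of the interpolant, which vanishes
  -- for `P` of degree at most `m`.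
  have hlag := Lagrange.coeff_eq_sum hinj (P := P) (by
    rw [Finset.card_range]
    exact degree_le_natDegree.trans_lt (by exact_mod_cast (by omega : P.natDegree < m + 2)))
  rw [Finset.card_range, coeff_eq_zero_of_natDegree_lt (by omega)] at hlag
  calc ∑ i ∈ Finset.range (m + 2), (-1) ^ i * ((-1) ^ (m + 1 - i) * W i)⁻¹ * P.eval (v i)
      = ∑ i ∈ Finset.range (m + 2), (-1) ^ (m + 1) * (P.eval (v i) / W i) := by
        refine Finset.sum_congr rfl fun i hi => ?_
        have hi' : i ≤ m + 1 := Nat.lt_succ_iff.1 (Finset.mem_range.1 hi)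
        rw [mul_inv, ← inv_pow, inv_neg_one, ← mul_assoc, ← pow_add, Nat.add_sub_cancel' hi']
        ring
    _ = 0 := by rw [← Finset.mul_sum, ← hlag, mul_zero]

open Polynomial in
/-- A polynomial bounded by `1` at the nodes cannot fall from `1` to `-1` between the first two
nodes, if a polynomial of the same degree that almost equioscillates at the other nodes does not
come close to `-1` there. -/
lemma comparison_polynomial_le {m : ℕ} {v : ℕ → ℝ}
    (hv : ∀ i j, i < j → j < m + 2 → v i < v j) {S C : ℝ[X]} (hS : S.natDegree ≤ m)
    (hC : C.natDegree ≤ m) (hS0 : S.eval (v 0) = 1) (hS1 : S.eval (v 1) = -1)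
    (hSb : ∀ i < m, |S.eval (v (i + 2))| ≤ 1) (hC0 : C.eval (v 0) = 1) {ε : ℝ} (hε0 : 0 ≤ ε) (hε : ε ≤ 1)
    (hCb : ∀ i < m, 1 - ε ≤ (-1) ^ (i + 1) * C.eval (v (i + 2))) :
    1 + C.eval (v 1) ≤ 2 * ε := by
  obtain ⟨a, ha, hsum⟩ := exists_alternating_weights hv
  have hsplit : ∀ P : ℝ[X], P.natDegree ≤ m → a 0 * P.eval (v 0) - a 1 * P.eval (v 1) =
      ∑ i ∈ Finset.range m, a (i + 2) * ((-1) ^ (i + 1) * P.eval (v (i + 2))) := by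
    intro P hP
    have h := hsum P hP
    rw [Finset.sum_range_succ', Finset.sum_range_succ'] at h
    have h' : ∑ i ∈ Finset.range m, (-1) ^ (i + 1 + 1) * a (i + 1 + 1) * P.eval (v (i + 1 + 1)) =
        -∑ i ∈ Finset.range m, a (i + 2) * ((-1) ^ (i + 1) * P.eval (v (i + 2))) := by
      rw [← Finset.sum_neg_distrib]
      refine Finset.sum_congr rfl fun i _ => ?_
      rw [pow_succ]
      ring
    rw [h'] at h
    simp only [zero_add, pow_one, pow_zero] at h
    linarith
  have hpos : ∀ i ∈ Finset.range m, 0 < a (i + 2) := fun i hi =>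
    ha _ (by have := Finset.mem_range.1 hi; omega)
  have h1 : a 0 + a 1 ≤ ∑ i ∈ Finset.range m, a (i + 2) := by
    have h := hsplit S hS
    rw [hS0, hS1] at h
    calc a 0 + a 1 = _ := by linarith
      _ ≤ _ := Finset.sum_le_sum fun i hi => ?_
    refine mul_le_of_le_one_right (hpos i hi).le ((le_abs_self _).trans ?_)
    rw [abs_mul, abs_pow, abs_neg, abs_one, one_pow, one_mul]
    exact hSb i (Finset.mem_range.1 hi)
  have h2 : (1 - ε) * ∑ i ∈ Finset.range m, a (i + 2) ≤ a 0 - a 1 * C.eval (v 1) := by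
    have h := hsplit C hC
    rw [hC0, mul_one] at h
    rw [h, Finset.mul_sum]
    refine Finset.sum_le_sum fun i hi => ?_
    rw [mul_comm]
    exact mul_le_mul_of_nonneg_left (hCb i (Finset.mem_range.1 hi)) (hpos i hi).le
  -- Test the relation on the polynomial vanishing at all nodes after the first two: it is positive
  -- and no larger at `v 1` than at `v 0`, so its weights compare the other way.
  have h3 : a 0 ≤ a 1 := by
    have hdeg : (∏ i ∈ Finset.range m, (Polynomial.C (v (i + 2)) - X)).natDegree ≤ m := by
      refine (natDegree_prod_le _ _).trans ?_
      refine (Finset.sum_le_sum fun i _ => ?_).trans (by simp : ∑ _i ∈ Finset.range m, 1 ≤ m)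
      exact (natDegree_sub_le _ _).trans (by simp)
    have h := hsplit _ hdeg
    simp only [eval_prod, eval_sub, eval_C, eval_X] at h
    rw [Finset.sum_eq_zero (fun i hi => by
      rw [Finset.prod_eq_zero hi (sub_self _), mul_zero, mul_zero]), sub_eq_zero] at h
    have hp1 : 0 < ∏ i ∈ Finset.range m, (v (i + 2) - v 1) := Finset.prod_pos fun i hi =>
      sub_pos.2 (hv _ _ (by omega) (by have := Finset.mem_range.1 hi; omega))
    have hle : ∏ i ∈ Finset.range m, (v (i + 2) - v 1) ≤
        ∏ i ∈ Finset.range m, (v (i + 2) - v 0) := by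
      refine Finset.prod_le_prod (fun i hi => ?_) fun i _ => ?_
      · exact sub_nonneg.2 (hv _ _ (by omega) (by have := Finset.mem_range.1 hi; omega)).le
      · linarith [hv 0 1 (by omega) (by omega)]
    refine le_of_mul_le_mul_right ?_ hp1
    rw [← h]
    exact mul_le_mul_of_nonneg_left hle (ha 0 (by omega)).le
  have ha1 : 0 < a 1 := ha 1 (by omega)
  have ha0 : 0 < a 0 := ha 0 (by omega)
  have h4 : (1 - ε) * (a 0 + a 1) ≤ a 0 - a 1 * C.eval (v 1) :=
    (mul_le_mul_of_nonneg_left h1 (by linarith)).trans h2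
  refine le_of_mul_le_mul_left ?_ ha1
  nlinarith [mul_nonneg hε0 (sub_nonneg.2 h3)]

open Polynomial in
/-- The polynomial `z ↦ T_m(1 - 2 z)`, which takes `sin² θ` to `cos (2 m θ)`. -/
noncomputable def shiftedChebyshev (m : ℕ) : ℝ[X] :=
  (Chebyshev.T ℝ m).comp (1 - 2 * X)

open Polynomial in
lemma natDegree_shiftedChebyshev_le (m : ℕ) : (shiftedChebyshev m).natDegree ≤ m := by
  rw [shiftedChebyshev]
  refine natDegree_comp_le.trans ?_
  have h1 : (Chebyshev.T ℝ m).natDegree = m := by simp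
  have h2 : (1 - 2 * X : ℝ[X]).natDegree ≤ 1 := by compute_degree
  rw [h1]
  exact (Nat.mul_le_mul_left m h2).trans (by simp)

lemma eval_shiftedChebyshev_sin_sq (m : ℕ) (θ : ℝ) :
    (shiftedChebyshev m).eval (Real.sin θ ^ 2) = Real.cos (2 * m * θ) := by
  have h : (1 - 2 * Real.sin θ ^ 2 : ℝ) = Real.cos (2 * θ) := by
    rw [Real.cos_two_mul, Real.sin_sq]
    ring
  have h2 : (shiftedChebyshev m).eval (Real.sin θ ^ 2) =
      (Polynomial.Chebyshev.T ℝ m).eval (1 - 2 * Real.sin θ ^ 2) := by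
    simp [shiftedChebyshev, Polynomial.eval_comp]
  rw [h2, h, Polynomial.Chebyshev.T_real_cos]
  push_cast
  ring_nf

lemma sum_range_two_mul (f : ℕ → ℝ) (M : ℕ) :
    ∑ i ∈ Finset.range (2 * M), f i = ∑ l ∈ Finset.range M, (f (2 * l) + f (2 * l + 1)) := by
  induction M with
  | zero => simp
  | succ M ih =>
    rw [mul_add, mul_one, Finset.sum_range_succ, Finset.sum_range_succ, ih, Finset.sum_range_succ]
    ring

-- Odd powers cancel in `R(y) + R(-y)`. Passing to the variable `y²` halves the degree, from twice
-- the number of queries to the number of queries.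
open Polynomial in
lemma exists_even_part (R : ℝ[X]) {m : ℕ} (hR : R.natDegree ≤ 2 * m) :
    ∃ S : ℝ[X], S.natDegree ≤ m ∧ ∀ y, R.eval y + R.eval (-y) = 2 * S.eval (y ^ 2) := by
  refine ⟨∑ l ∈ Finset.range (m + 1), Polynomial.C (R.coeff (2 * l)) * X ^ l, ?_, fun y => ?_⟩
  · refine natDegree_sum_le_of_forall_le _ _ fun l hl => (natDegree_C_mul_X_pow_le _ _).trans ?_
    exact Nat.lt_succ_iff.1 (Finset.mem_range.1 hl)
  · rw [eval_eq_sum_range' (n := 2 * (m + 1)) (by omega),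
      eval_eq_sum_range' (n := 2 * (m + 1)) (by omega), ← Finset.sum_add_distrib,
      sum_range_two_mul, eval_finsetSum, Finset.mul_sum]
    refine Finset.sum_congr rfl fun l _ => ?_
    simp only [eval_mul, eval_C, eval_pow, eval_X, pow_mul, pow_succ _ (2 * l),
      neg_sq]
    ring

/-! ### Grid approximation and the lower bound -/

lemma tendsto_floor_mul_nat_div (s : ℝ) (hs : 0 ≤ s) :
    Filter.Tendsto (fun h : ℕ => (⌊s * h⌋₊ / h : ℝ)) Filter.atTop (nhds s) :=
  (tendsto_nat_floor_mul_div_atTop hs).comp tendsto_natCast_atTop_atTop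

/-- For large `h` the squares of the multiples of `1 / h` contain almost-extremal points of
`shiftedChebyshev m`. -/
lemma eventually_grid_nodes {m : ℕ} (hm : 1 ≤ m) {b ε : ℝ} (hb : 0 ≤ b)
    (hbm : b < Real.sin (Real.pi / (2 * m))) (hε : 0 < ε) :
    ∃ N : ℕ, ∀ h : ℕ, N ≤ h → ∃ u : ℕ → ℕ, (∀ i < m, u i ≤ h) ∧
      (∀ i < m, b < (u i : ℝ) / h) ∧ (∀ i j, i < j → j < m → (u i : ℝ) / h < u j / h) ∧
      ∀ i < m, 1 - ε ≤ (-1) ^ (i + 1) * (shiftedChebyshev m).eval (((u i : ℝ) / h) ^ 2) := by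
  -- At `(s i)²` the shifted Chebyshev polynomial equals `(-1)^(i+1)`; the extremum at `0` is left
  -- out, since `0` is a node of its own.
  set s : ℕ → ℝ := fun i => Real.sin ((i + 1) * (Real.pi / (2 * m))) with hs
  have hm0 : (0 : ℝ) < m := by exact_mod_cast hm
  have hq : 0 < Real.pi / (2 * m) := by positivity
  have hmax : ∀ i < m, ((i : ℝ) + 1) * (Real.pi / (2 * m)) ≤ Real.pi / 2 := by
    intro i hi
    have hi' : ((i : ℝ) + 1) ≤ m := by exact_mod_cast hi
    calc ((i : ℝ) + 1) * (Real.pi / (2 * m)) ≤ m * (Real.pi / (2 * m)) := by gcongr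
      _ = Real.pi / 2 := by field_simp
  have hmono : ∀ i j, i < j → j < m → s i < s j := by
    intro i j hij hj
    have hij' : (i : ℝ) < j := by exact_mod_cast hij
    refine Real.sin_lt_sin_of_lt_of_le_pi_div_two ?_ (hmax j hj) ?_
    · have : 0 ≤ ((i : ℝ) + 1) * (Real.pi / (2 * m)) := by positivity
      linarith [Real.pi_pos]
    · gcongr
  have hbs : ∀ i < m, b < s i := by
    intro i hi
    have h0 : b < s 0 := by simpa [hs] using hbm
    rcases Nat.eq_zero_or_pos i with rfl | h
    · exact h0
    · exact h0.trans (hmono 0 i h hi)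
  have hlim : ∀ i < m, Filter.Tendsto (fun h : ℕ => (⌊s i * h⌋₊ / h : ℝ)) Filter.atTop
      (nhds (s i)) := fun i hi => tendsto_floor_mul_nat_div _ (hb.trans (hbs i hi).le)
  have hcheb : ∀ i < m, Filter.Tendsto (fun h : ℕ => (-1) ^ (i + 1) *
      (shiftedChebyshev m).eval ((⌊s i * h⌋₊ / h : ℝ) ^ 2)) Filter.atTop (nhds 1) := by
    intro i hi
    have h1 := (((shiftedChebyshev m).continuous.tendsto _).comp ((hlim i hi).pow 2)).const_mul
      ((-1 : ℝ) ^ (i + 1))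
    have : 2 * (m : ℝ) * ((i + 1) * (Real.pi / (2 * m))) = ((i + 1 : ℕ) : ℝ) * Real.pi := by
      push_cast
      field_simp
    rw [eval_shiftedChebyshev_sin_sq, this, Real.cos_nat_mul_pi, ← mul_pow, neg_one_mul,
      neg_neg, one_pow] at h1
    exact h1
  have key : ∀ᶠ h : ℕ in Filter.atTop,
      (∀ i ∈ Finset.range m, b < (⌊s i * h⌋₊ : ℝ) / h) ∧
      (∀ i ∈ Finset.range m, ∀ j ∈ Finset.range m, i < j →
        (⌊s i * h⌋₊ : ℝ) / h < ⌊s j * h⌋₊ / h) ∧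
      ∀ i ∈ Finset.range m, 1 - ε ≤ (-1) ^ (i + 1) *
        (shiftedChebyshev m).eval ((⌊s i * h⌋₊ / h : ℝ) ^ 2) := by
    refine Filter.Eventually.and ?_ (Filter.Eventually.and ?_ ?_)
    · refine (Filter.eventually_all_finset _).2 fun i hi => ?_
      exact (hlim i (Finset.mem_range.1 hi)).eventually_const_lt (hbs i (Finset.mem_range.1 hi))
    · refine (Filter.eventually_all_finset _).2 fun i hi =>
        (Filter.eventually_all_finset _).2 fun j hj => ?_
      by_cases hij : i < j
      · have hj' := Finset.mem_range.1 hj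
        filter_upwards [(hlim i (Finset.mem_range.1 hi)).eventually_lt (hlim j hj')
          (hmono i j hij hj')] with h hh _ using hh
      · exact Filter.Eventually.of_forall fun h hlt => absurd hlt hij
    · refine (Filter.eventually_all_finset _).2 fun i hi => ?_
      exact (hcheb i (Finset.mem_range.1 hi)).eventually_const_le (by linarith)
  obtain ⟨N, hN⟩ := Filter.eventually_atTop.1 key
  refine ⟨N, fun h hh => ⟨fun i => ⌊s i * h⌋₊, fun i _ => ?_, fun i hi => ?_,
    fun i j hij hj => ?_, fun i hi => ?_⟩⟩
  · refine Nat.floor_le_of_le ?_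
    exact mul_le_of_le_one_left (Nat.cast_nonneg h) (Real.sin_le_one _)
  · exact (hN h hh).1 i (Finset.mem_range.2 hi)
  · exact (hN h hh).2.1 i (Finset.mem_range.2 (hij.trans hj)) j (Finset.mem_range.2 hj) hij
  · exact (hN h hh).2.2 i (Finset.mem_range.2 hi)

/-- The lower bound: `m` queries do not suffice for `g_n^k` if `1 - 2 k / n ≤ b` and
`b < sin (π / (2 m))`. -/
lemma exists_forall_not_computesExactly {m : ℕ} (hm : 1 ≤ m) {b : ℝ}
    (hbm : b < Real.sin (Real.pi / (2 * m))) :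
    ∃ N : ℕ, ∀ h : ℕ, N ≤ h → ∀ k : ℕ, k < h → 1 - (k : ℝ) / h ≤ b →
      ∀ A : QuantumQueryAlgorithm (2 * h), A.queries ≤ m →
        ¬ A.ComputesExactly (gFun (2 * h) k) := by
  have hm0 : (0 : ℝ) < m := by exact_mod_cast hm
  have hm1 : (1 : ℝ) ≤ m := by exact_mod_cast hm
  rcases lt_or_ge b 0 with hb | hb
  · refine ⟨0, fun h _ k hk hkb => ?_⟩
    have : (k : ℝ) / h < 1 := by
      have : (0 : ℝ) < h := by exact_mod_cast (by omega : 0 < h)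
      rw [div_lt_one this]
      exact_mod_cast hk
    linarith
  have hq : Real.pi / (2 * m) ≤ Real.pi / 2 := by
    gcongr
    linarith
  have hq0 : 0 < Real.pi / (2 * m) := by positivity
  set φ₀ := Real.arcsin b
  have hφ₀ : φ₀ < Real.pi / (2 * m) := by
    rw [← Real.arcsin_sin (x := Real.pi / (2 * m)) (by linarith) hq]
    exact Real.strictMonoOn_arcsin ⟨by linarith, by linarith [Real.sin_le_one (Real.pi / (2 * m))]⟩
      ⟨by linarith, Real.sin_le_one _⟩ hbm
  have hφ₀' : 0 ≤ φ₀ := Real.arcsin_nonneg.2 hb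
  have h2m : 2 * m * φ₀ < Real.pi := by
    rw [lt_div_iff₀ (by positivity)] at hφ₀
    linarith
  have hcos : -1 < Real.cos (2 * m * φ₀) := by
    rw [← Real.cos_pi]
    exact Real.cos_lt_cos_of_nonneg_of_le_pi (by positivity) le_rfl h2m
  -- The value of `shiftedChebyshev m` at `y²` is at least `cos (2mφ₀) = 4ε - 1`, so the conclusion
  -- `1 + C(y²) ≤ 2ε` of the comparison will be contradictory. This `ε` depends on `b` and `m` only,
  -- so the threshold is uniform in `k`.
  set ε := (1 + Real.cos (2 * m * φ₀)) / 4 with hε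
  have hε0 : 0 < ε := by linarith
  have hε1 : ε ≤ 1 := by linarith [Real.cos_le_one (2 * m * φ₀)]
  obtain ⟨N, hN⟩ := eventually_grid_nodes hm hb hbm hε0
  refine ⟨N, fun h hh k hk hkb A hAm hA => ?_⟩
  obtain ⟨u, huh, hub, hu, hcheb⟩ := hN h hh
  obtain ⟨P, hP, hP01, hPh, hPk, hPk'⟩ := exists_polynomial_of_computesExactly hk hA
  have hh0 : (0 : ℝ) < h := by exact_mod_cast (by omega : 0 < h)
  set y := 1 - (k : ℝ) / h with hy
  have hkh : (k : ℝ) < h := by exact_mod_cast hk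
  have hy0 : 0 < y := by
    have : (k : ℝ) / h < 1 := by rwa [div_lt_one hh0]
    linarith
  -- The substitution `w = h - h z` centres the weight at `h` and scales it by `h`, so the zeros `k`
  -- and `2h - k` become `± y`.
  obtain ⟨S, hS, hSR⟩ := exists_even_part
    (P.comp (Polynomial.C (h : ℝ) - Polynomial.C (h : ℝ) * Polynomial.X)) (m := m) (by
      refine Polynomial.natDegree_comp_le.trans ?_
      have h2 : (Polynomial.C (h : ℝ) - Polynomial.C (h : ℝ) * Polynomial.X).natDegree ≤ 1 := by
        compute_degree
      exact (Nat.mul_le_mul hP h2).trans (by omega))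
  have hSR' : ∀ z : ℝ, P.eval (h - h * z) + P.eval (h + h * z) = 2 * S.eval (z ^ 2) := by
    intro z
    have := hSR z
    simpa [Polynomial.eval_comp] using this
  have hgrid : ∀ w : ℕ, w ≤ h → P.eval ((h - w : ℕ) : ℝ) + P.eval ((h + w : ℕ) : ℝ) =
      2 * S.eval (((w : ℝ) / h) ^ 2) := by
    intro w hw
    rw [← hSR' (w / h), mul_div_cancel₀ _ hh0.ne', Nat.cast_sub hw, Nat.cast_add]
  set v : ℕ → ℝ := fun i => match i with
    | 0 => 0
    | 1 => y ^ 2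
    | i + 2 => ((u i : ℝ) / h) ^ 2 with hv
  have hmono : ∀ i j, i < j → j < m + 2 → v i < v j := by
    intro i j hij hj
    match i, j with
    | 0, 1 => exact pow_pos hy0 2
    | 0, j + 2 =>
      have := hub j (by omega)
      exact pow_pos (hb.trans_lt this) 2
    | 1, j + 2 =>
      have := hub j (by omega)
      exact pow_lt_pow_left₀ (hkb.trans_lt this) hy0.le two_ne_zero
    | i + 2, j + 2 =>
      have := hu i j (by omega) (by omega)
      exact pow_lt_pow_left₀ this (by positivity) two_ne_zero
  have hle := comparison_polynomial_le hmono (S := 2 * S - 1) (C := shiftedChebyshev m)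
    (ε := ε) ?_ (natDegree_shiftedChebyshev_le m) ?_ ?_ ?_ ?_ hε0.le hε1 hcheb
  · have hvy : v 1 = Real.sin (Real.arcsin y) ^ 2 := by
      rw [Real.sin_arcsin (by linarith)
        (hkb.trans (hbm.le.trans (Real.sin_le_one _)))]
    rw [hvy, eval_shiftedChebyshev_sin_sq] at hle
    have hφ : Real.arcsin y ≤ φ₀ := Real.monotone_arcsin hkb
    have hφ' : 0 ≤ Real.arcsin y := Real.arcsin_nonneg.2 hy0.le
    have : Real.cos (2 * m * φ₀) ≤ Real.cos (2 * m * Real.arcsin y) :=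
      Real.cos_le_cos_of_nonneg_of_le_pi (by positivity) h2m.le (by gcongr)
    linarith
  · refine (Polynomial.natDegree_sub_le _ _).trans (max_le ?_ (by simp))
    refine Polynomial.natDegree_mul_le.trans ?_
    simpa using hS
  · have := hgrid 0 (by omega)
    simp only [Nat.sub_zero, Nat.add_zero, hPh] at this
    simp only [hv, Polynomial.eval_sub, Polynomial.eval_mul, Polynomial.eval_ofNat,
      Polynomial.eval_one]
    norm_num at this ⊢
    linarith
  · have h1 := hSR' y
    have e1 : (h : ℝ) - h * y = k := by
      rw [hy]
      field_simp
      ring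
    have e2 : (h : ℝ) + h * y = ((2 * h - k : ℕ) : ℝ) := by
      rw [hy, Nat.cast_sub (by omega)]
      push_cast
      field_simp
      ring
    rw [e1, e2, hPk, hPk'] at h1
    simp only [hv, Polynomial.eval_sub, Polynomial.eval_mul, Polynomial.eval_ofNat,
      Polynomial.eval_one]
    linarith
  · intro i hi
    have h1 := hgrid (u i) (huh i hi)
    have h2 := hP01 (h - u i) (by omega)
    have h3 := hP01 (h + u i) (by have := huh i hi; omega)
    simp only [hv, Polynomial.eval_sub, Polynomial.eval_mul, Polynomial.eval_ofNat,
      Polynomial.eval_one]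
    rw [abs_le]
    constructor <;> linarith
  · simpa using eval_shiftedChebyshev_sin_sq m 0

/-! ### Reflections and their Chebyshev recurrence -/

/-- The reflection `1 - 2 r rᵀ` for a real unit vector `r`. -/
def reflectionMatrix {ι : Type*} [DecidableEq ι] (r : ι → ℂ) : Matrix ι ι ℂ :=
  1 - (2 : ℂ) • Matrix.vecMulVec r r

lemma reflectionMatrix_mulVec {ι : Type*} [Fintype ι] [DecidableEq ι] (r φ : ι → ℂ) :
    (reflectionMatrix r).mulVec φ = φ - (2 * (r ⬝ᵥ φ)) • r := by
  rw [reflectionMatrix, Matrix.sub_mulVec, Matrix.one_mulVec, Matrix.smul_mulVec,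
    Matrix.vecMulVec_mulVec]
  ext s
  simp [mul_assoc]

lemma reflectionMatrix_mem_unitaryGroup {ι : Type*} [Fintype ι] [DecidableEq ι] {r : ι → ℂ}
    (hr : star r = r) (h1 : r ⬝ᵥ r = 1) : reflectionMatrix r ∈ Matrix.unitaryGroup ι ℂ := by
  have hstar : star (reflectionMatrix r) = reflectionMatrix r := by
    rw [reflectionMatrix, star_sub, star_one, star_smul, Matrix.star_eq_conjTranspose,
      Matrix.conjTranspose_vecMulVec, hr]
    simp
  rw [Matrix.mem_unitaryGroup_iff, hstar, Matrix.ext_iff_mulVec]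
  intro φ
  rw [← Matrix.mulVec_mulVec, reflectionMatrix_mulVec, reflectionMatrix_mulVec, dotProduct_sub,
    dotProduct_smul, h1, Matrix.one_mulVec]
  module

lemma neg_mem_unitaryGroup {ι : Type*} [Fintype ι] [DecidableEq ι] {M : Matrix ι ι ℂ}
    (hM : M ∈ Matrix.unitaryGroup ι ℂ) : -M ∈ Matrix.unitaryGroup ι ℂ := by
  rw [Matrix.mem_unitaryGroup_iff] at *
  simpa using hM

/-- The Householder reflection that exchanges a basis vector and a real unit vector. -/
lemma exists_unitary_exchanging {ι : Type*} [Fintype ι] [DecidableEq ι] (e : ι) {v : ι → ℝ}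
    (h1 : ∑ s, v s ^ 2 = 1) (he : v e < 1) :
    ∃ H : Matrix ι ι ℂ, H ∈ Matrix.unitaryGroup ι ℂ ∧
      H.mulVec (Pi.single e 1) = (fun s => (v s : ℂ)) ∧
      ∀ φ, H.mulVec φ e = (fun s => (v s : ℂ)) ⬝ᵥ φ := by
  -- This is the length of `e - v` for unit vectors, hence the normalization of the reflection
  -- vector; it is nonzero because `v e < 1`.
  set c : ℝ := √(2 * (1 - v e)) with hc
  have hc2 : c ^ 2 = 2 * (1 - v e) := Real.sq_sqrt (by linarith)
  have hc0 : c ≠ 0 := (Real.sqrt_pos.2 (by linarith)).ne'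
  have hcC : (c : ℂ) ≠ 0 := by exact_mod_cast hc0
  have hc2C : (c : ℂ) ^ 2 = 2 * (1 - v e) := by exact_mod_cast hc2
  have h1C : (fun s => (v s : ℂ)) ⬝ᵥ (fun s => (v s : ℂ)) = 1 := by
    simp only [dotProduct, ← pow_two]
    exact_mod_cast h1
  set w : ι → ℂ := fun s => (v s : ℂ) with hw
  set r : ι → ℂ := (c : ℂ)⁻¹ • (Pi.single e 1 - w) with hr
  have hrr : r ⬝ᵥ r = 1 := by
    simp only [hr, smul_dotProduct, dotProduct_smul, sub_dotProduct, dotProduct_sub, h1C,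
      single_dotProduct, dotProduct_single, Pi.single_eq_same, Pi.smul_apply, Pi.sub_apply,
      smul_eq_mul]
    field_simp
    rw [hc2C]
    simp only [hw]
    ring
  have hrstar : star r = r := by
    ext s
    by_cases hs : s = e
    · subst hs; simp [hr, hw]
    · simp [hr, hw, hs]
  have hne : (1 - w e) ≠ 0 := by
    intro h0
    rw [hw] at h0
    simp only at h0
    rw [h0, mul_zero] at hc2C
    exact hcC (pow_eq_zero_iff two_ne_zero |>.1 hc2C)
  have key : ∀ φ, (reflectionMatrix r).mulVec φ = φ -
      ((φ e - w ⬝ᵥ φ) / (1 - w e)) • (Pi.single e 1 - w) := by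
    intro φ
    rw [reflectionMatrix_mulVec, hr, smul_smul, smul_dotProduct, sub_dotProduct,
      single_dotProduct, smul_eq_mul]
    congr 2
    have : (2 * (1 - w e) : ℂ) = c ^ 2 := hc2C.symm
    field_simp
    rw [← this]
    ring
  refine ⟨reflectionMatrix r, reflectionMatrix_mem_unitaryGroup hrstar hrr, ?_, fun φ => ?_⟩
  · rw [key, dotProduct_single, Pi.single_eq_same, mul_one, div_self hne, one_smul, sub_sub_cancel]
  · rw [key]
    simp only [Pi.sub_apply, Pi.smul_apply, Pi.single_eq_same, smul_eq_mul]
    field_simp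
    ring

open Polynomial in
/-- One step of the iteration: `v` and `σ v` span a plane on which the product of the two
reflections acts by the recurrence of the Chebyshev polynomials of the second kind. -/
lemma neg_reflectionMatrix_mulVec_chebyshev {ι : Type*} [Fintype ι] [DecidableEq ι]
    {v σ : ι → ℂ} (hv : v ⬝ᵥ v = 1) (hσ : σ * σ = 1) {a : ℂ} (ha : v ⬝ᵥ (σ * v) = a) (t : ℤ) :
    (-reflectionMatrix v).mulVec (σ * ((Chebyshev.U ℂ t).eval a • v -
      (Chebyshev.U ℂ (t - 1)).eval a • (σ * v))) =
      (Chebyshev.U ℂ (t + 1)).eval a • v - (Chebyshev.U ℂ t).eval a • (σ * v) := by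
  have hσσ : σ * (σ * v) = v := by rw [← mul_assoc, hσ, one_mul]
  have hU : (Chebyshev.U ℂ (t + 1)).eval a =
      2 * a * (Chebyshev.U ℂ t).eval a - (Chebyshev.U ℂ (t - 1)).eval a := by
    rw [Chebyshev.U_add_one]
    simp
  rw [Matrix.neg_mulVec, reflectionMatrix_mulVec, mul_sub, mul_smul_comm, mul_smul_comm, hσσ,
    dotProduct_sub, dotProduct_smul, dotProduct_smul, ha, hv, hU, smul_eq_mul, smul_eq_mul]
  module

/-! ### The Chebyshev algorithm and the upper bound -/

/-- The sign of the basis state `s` under the oracle, followed by a sign flip of `|0⟩|1⟩`. -/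
def querySign {n : ℕ} (x : Fin n → Bool) : QueryBasis n 1 → ℝ
  | (none, w) => if w = 0 then 1 else -1
  | (some i, _) => if x i = true then -1 else 1

/-- The sign flip of `|0⟩|1⟩`. -/
def signFlip (n : ℕ) : Matrix (QueryBasis n 1) (QueryBasis n 1) ℂ :=
  Matrix.diagonal fun s => if s = (none, 1) then -1 else 1

lemma signFlip_mem_unitaryGroup (n : ℕ) : signFlip n ∈ Matrix.unitaryGroup (QueryBasis n 1) ℂ := by
  rw [Matrix.mem_unitaryGroup_iff, Matrix.star_eq_conjTranspose, signFlip,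
    Matrix.diagonal_conjTranspose, Matrix.diagonal_mul_diagonal, ← Matrix.diagonal_one]
  congr 1
  funext s
  by_cases hs : s = (none, 1) <;> simp [hs]

lemma signFlip_mulVec_phaseOracle {n : ℕ} (x : Fin n → Bool) (ψ : QueryBasis n 1 → ℂ) :
    (signFlip n).mulVec ((phaseOracle 1 x).mulVec ψ) = (fun s => (querySign x s : ℂ)) * ψ := by
  ext s
  rw [signFlip, Matrix.mulVec_diagonal, phaseOracle_mulVec]
  rcases s with ⟨_ | i, w⟩
  · fin_cases w <;> simp [querySign]
  · simp [querySign]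

lemma querySign_mul_self {n : ℕ} (x : Fin n → Bool) :
    (fun s => (querySign x s : ℂ)) * (fun s => (querySign x s : ℂ)) = 1 := by
  ext s
  rcases s with ⟨_ | i, w⟩
  · by_cases hw : w = 0 <;> simp [querySign, hw]
  · by_cases hx : x i = true <;> simp [querySign, hx]

/-- The start vector of the iteration: it has weight `b` on the idle states and weight `1 - b` on
the uniform superposition of the input positions. -/
noncomputable def queryVector (n : ℕ) (b : ℝ) : QueryBasis n 1 → ℝ
  | (none, _) => √(b / 2)
  | (some _, w) => if w = 0 then √((1 - b) / n) else 0

lemma sum_queryVector_sq {n : ℕ} (hn : 0 < n) {b : ℝ} (hb0 : 0 ≤ b) (hb1 : b ≤ 1) :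
    ∑ s, queryVector n b s ^ 2 = 1 := by
  have hn0 : (0 : ℝ) < n := by exact_mod_cast hn
  have h1 : √(b / 2) ^ 2 = b / 2 := Real.sq_sqrt (by positivity)
  have h2 : √((1 - b) / n) ^ 2 = (1 - b) / n := Real.sq_sqrt (div_nonneg (by linarith) hn0.le)
  rw [Fintype.sum_prod_type, Fintype.sum_option]
  have h3 : ∀ i : Fin n, ∑ w : Fin 2, queryVector n b (some i, w) ^ 2 = (1 - b) / n := by
    intro i
    simp only [Fin.sum_univ_two, queryVector]
    simp only [if_true, one_ne_zero, if_false, h2]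
    ring
  have h4 : ∑ w : Fin 2, queryVector n b (none, w) ^ 2 = b := by
    simp only [Fin.sum_univ_two, queryVector, h1]
    ring
  refine (congrArg₂ (· + ·) h4 (Finset.sum_congr rfl fun i _ => h3 i)).trans ?_
  rw [Finset.sum_const, Finset.card_univ, Fintype.card_fin, nsmul_eq_mul]
  field_simp
  ring

lemma sum_sign_eq {n : ℕ} (x : Fin n → Bool) :
    ∑ i, (if x i = true then (-1 : ℝ) else 1) = n - 2 * hammingWeight x := by
  have h : ∀ i, (if x i = true then (-1 : ℝ) else 1) = 1 - 2 * (if x i = true then 1 else 0) := by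
    intro i
    by_cases hx : x i = true <;> simp [hx]
    norm_num
  simp only [h, Finset.sum_sub_distrib, ← Finset.mul_sum, Finset.sum_boole, hammingWeight]
  simp

/-- The two idle states carry equal weight and opposite signs, so they cancel. Idle weight `b` thus
rescales the expectation of the oracle by `1 - b`, without shifting it. -/
lemma sum_querySign_mul_queryVector_sq {n : ℕ} (hn : 0 < n) {b : ℝ} (hb1 : b ≤ 1)
    (x : Fin n → Bool) :
    ∑ s, queryVector n b s * (querySign x s * queryVector n b s) =
      (1 - b) * (1 - 2 * (hammingWeight x : ℝ) / n) := by
  have hn0 : (0 : ℝ) < n := by exact_mod_cast hn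
  have h2 : √((1 - b) / n) * √((1 - b) / n) = (1 - b) / n :=
    Real.mul_self_sqrt (div_nonneg (by linarith) hn0.le)
  rw [Fintype.sum_prod_type, Fintype.sum_option]
  have h3 : ∀ i : Fin n, ∑ w : Fin 2, queryVector n b (some i, w) *
      (querySign x (some i, w) * queryVector n b (some i, w)) =
      (1 - b) / n * (if x i = true then -1 else 1) := by
    intro i
    simp only [Fin.sum_univ_two, queryVector, querySign]
    simp only [if_true, one_ne_zero, if_false, mul_zero, add_zero]
    rw [mul_left_comm, h2, mul_comm]
  rw [Finset.sum_congr rfl fun i _ => h3 i, ← Finset.mul_sum, sum_sign_eq]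
  simp only [queryVector, querySign]
  simp
  field_simp

open Polynomial in
/-- The Chebyshev amplification algorithm: with `d` queries, the amplitude of the initial basis
state after the last unitary is `T_d` of the expectation value of the oracle. -/
lemma exists_algorithm_chebyshev {n d : ℕ} (hn : 0 < n) (hd : 0 < d) {b : ℝ} (hb0 : 0 ≤ b)
    (hb1 : b ≤ 1) (target : Bool) :
    ∃ A : QuantumQueryAlgorithm n, A.queries = d ∧ ∀ x : Fin n → Bool, A.outputProb x target =
      ((Chebyshev.T ℝ d).eval ((1 - b) * (1 - 2 * (hammingWeight x : ℝ) / n))) ^ 2 := by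
  have hsq := sum_queryVector_sq hn hb0 hb1
  have hlt : queryVector n b (none, 0) < 1 := by
    simp only [queryVector]
    rw [Real.sqrt_lt' one_pos]
    linarith
  obtain ⟨H, hH, hHe, hHv⟩ := exists_unitary_exchanging (none, 0) hsq hlt
  set v : QueryBasis n 1 → ℂ := fun s => (queryVector n b s : ℂ) with hv
  have hvstar : star v = v := by
    ext s
    simp [hv]
  have hvv : v ⬝ᵥ v = 1 := by
    simp only [hv, dotProduct, ← pow_two]
    exact_mod_cast hsq
  have hR : -reflectionMatrix v * signFlip n ∈ Matrix.unitaryGroup (QueryBasis n 1) ℂ :=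
    mul_mem (neg_mem_unitaryGroup (reflectionMatrix_mem_unitaryGroup hvstar hvv))
      (signFlip_mem_unitaryGroup n)
  -- `H` prepares `v` from the initial basis state, and at the end it turns the overlap with `v`
  -- into the amplitude of that same basis state, the only outcome mapped to `target`.
  let A : QuantumQueryAlgorithm n :=
    { queries := d
      workspace := 1
      U := fun t => if t = 0 then ⟨H, hH⟩ else if t = d then ⟨H, hH⟩ * ⟨_, hR⟩ else ⟨_, hR⟩
      out := fun s => if s = (none, 0) then target else !target }
  refine ⟨A, rfl, fun x => ?_⟩
  set σ : QueryBasis n 1 → ℂ := fun s => (querySign x s : ℂ) with hσ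
  set a : ℝ := (1 - b) * (1 - 2 * (hammingWeight x : ℝ) / n) with ha
  have hva : v ⬝ᵥ (σ * v) = (a : ℂ) := by
    rw [ha, ← sum_querySign_mul_queryVector_sq hn hb1 x]
    simp [hv, hσ, dotProduct]
  have hstep : ∀ (t : ℕ) (ψ : QueryBasis n 1 → ℂ),
      ψ = (Chebyshev.U ℂ t).eval (a : ℂ) • v - (Chebyshev.U ℂ (t - 1)).eval (a : ℂ) • (σ * v) →
      (-reflectionMatrix v * signFlip n).mulVec ((phaseOracle 1 x).mulVec ψ) =
        (Chebyshev.U ℂ (t + 1 : ℕ)).eval (a : ℂ) • v -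
          (Chebyshev.U ℂ ((t + 1 : ℕ) - 1)).eval (a : ℂ) • (σ * v) := by
    intro t ψ hψ
    rw [← Matrix.mulVec_mulVec, signFlip_mulVec_phaseOracle, hψ,
      neg_reflectionMatrix_mulVec_chebyshev hvv (querySign_mul_self x) hva]
    push_cast
    rw [add_sub_cancel_right]
  have hstate : ∀ t < d, A.stateAfter x t = (Chebyshev.U ℂ t).eval (a : ℂ) • v -
      (Chebyshev.U ℂ (t - 1)).eval (a : ℂ) • (σ * v) := by
    intro t
    induction t with
    | zero =>
      intro _
      simp only [QuantumQueryAlgorithm.stateAfter, A, if_true]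
      rw [hHe]
      simp
    | succ t ih =>
      intro ht
      have hU : ((A.U (t + 1) : Matrix.unitaryGroup (QueryBasis n 1) ℂ) :
          Matrix (QueryBasis n 1) (QueryBasis n 1) ℂ) = -reflectionMatrix v * signFlip n := by
        simp only [A]
        rw [if_neg t.succ_ne_zero, if_neg ht.ne]
      simp only [QuantumQueryAlgorithm.stateAfter]
      exact hU ▸ hstep t _ (ih (by omega))
  -- The overlap of `v` with `U_d(a) v - U_{d-1}(a) σv` is `U_d(a) - a U_{d-1}(a) = T_d(a)`.
  have hfinal : A.stateAfter x d (none, 0) = ((Chebyshev.T ℝ d).eval a : ℝ) := by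
    obtain ⟨t, rfl⟩ : ∃ t, d = t + 1 := ⟨d - 1, by omega⟩
    have hU : ((A.U (t + 1) : Matrix.unitaryGroup (QueryBasis n 1) ℂ) :
        Matrix (QueryBasis n 1) (QueryBasis n 1) ℂ) =
          H * (-reflectionMatrix v * signFlip n) := by
      simp only [A]
      rw [if_neg t.succ_ne_zero, if_pos trivial]
      rfl
    have h1 : A.stateAfter x (t + 1) = (H * (-reflectionMatrix v * signFlip n)).mulVec
        ((phaseOracle 1 x).mulVec (A.stateAfter x t)) := by
      simp only [QuantumQueryAlgorithm.stateAfter]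
      exact hU ▸ rfl
    rw [h1, ← Matrix.mulVec_mulVec, hHv, hstep t _ (hstate t (by omega)), dotProduct_sub,
      dotProduct_smul, dotProduct_smul, hvv, hva, Chebyshev.complex_ofReal_eval_T,
      Chebyshev.T_eq_U_sub_X_mul_U]
    simp only [smul_eq_mul, eval_sub, eval_mul, eval_X]
    ring
  have hfilter : (Finset.univ.filter fun s => A.out s = target) = {(none, 0)} := by
    ext s
    by_cases hs : s = (none, 0) <;> simp [A, hs]
  rw [QuantumQueryAlgorithm.outputProb, hfilter, Finset.sum_singleton]
  change ‖A.stateAfter x d (none, 0)‖ ^ 2 = _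
  rw [hfinal, Complex.norm_real, Real.norm_eq_abs, sq_abs]

open Polynomial in
/-- The upper bound: `d` queries suffice for `g_n^k` if `1 - 2 k / n ≥ sin (π / (2 d))`. -/
lemma exists_computesExactly {n k d : ℕ} (hn : 0 < n) (hd : 0 < d)
    (hk : Real.sin (Real.pi / (2 * d)) ≤ 1 - 2 * (k : ℝ) / n) :
    ∃ A : QuantumQueryAlgorithm n, A.queries = d ∧ A.ComputesExactly (gFun n k) := by
  have hn0 : (0 : ℝ) < n := by exact_mod_cast hn
  have hd1 : (1 : ℝ) ≤ d := by exact_mod_cast hd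
  have hd0 : (0 : ℝ) < d := by linarith
  set q := Real.pi / (2 * d) with hq
  set y := 1 - 2 * (k : ℝ) / n with hy
  have hq0 : 0 < q := by positivity
  have hqpi : q < Real.pi := by
    rw [hq, div_lt_iff₀ (by positivity)]
    nlinarith [Real.pi_pos]
  have hsin : 0 < Real.sin q := Real.sin_pos_of_pos_of_lt_pi hq0 hqpi
  have hy0 : 0 < y := hsin.trans_le hk
  have hdq : d * q = Real.pi / 2 := by
    rw [hq]
    field_simp
  -- With `1 - b = c` the outer layers have expectation `± sin q = cos (π/2 ∓ q)`, where `T_d` is `±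
  -- sin (dπ/2)`; the middle layer has expectation `0`, where `T_d` is `cos (dπ/2)`. The hypothesis
  -- `hk` is what makes `c ≤ 1`.
  set c := Real.sin q / y with hc
  have hcy : c * y = Real.sin q := div_mul_cancel₀ _ hy0.ne'
  -- For even `d` the amplitude has modulus `1` on the middle layer, for odd `d` on the outer ones,
  -- so the announced bit follows the parity of `d`.
  obtain ⟨A, hAd, hA⟩ := exists_algorithm_chebyshev hn hd (b := 1 - c)
    (sub_nonneg.2 ((div_le_one hy0).2 hk)) (by have : 0 < c := by positivity
                                               linarith) (decide (Even d))
  rw [sub_sub_cancel] at hA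
  have hhalf : ∀ x : Fin n → Bool, 2 * hammingWeight x = n →
      A.outputProb x (decide (Even d)) = Real.cos (d * (Real.pi / 2)) ^ 2 := by
    intro x hx
    have hx' : 2 * (hammingWeight x : ℝ) = n := by exact_mod_cast hx
    rw [hA, hx', div_self hn0.ne', sub_self, mul_zero, ← Real.cos_pi_div_two,
      Chebyshev.T_real_cos]
    rfl
  have hside : ∀ x : Fin n → Bool, hammingWeight x = k ∨ hammingWeight x + k = n →
      A.outputProb x (decide (Even d)) = Real.sin (d * (Real.pi / 2)) ^ 2 := by
    rintro x (hx | hx)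
    · rw [hA, hx, hcy, ← Real.cos_pi_div_two_sub, Chebyshev.T_real_cos, Int.cast_natCast, mul_sub,
        hdq, Real.cos_sub_pi_div_two]
    · have hx' : 1 - 2 * (hammingWeight x : ℝ) / n = -y := by
        have hw : (hammingWeight x : ℝ) = n - k := by
          rw [eq_sub_iff_add_eq]
          exact_mod_cast hx
        rw [hw, hy]
        field_simp
        ring
      rw [hA, hx', mul_neg, hcy, ← Real.sin_neg, ← Real.cos_pi_div_two_sub, Chebyshev.T_real_cos,
        Int.cast_natCast, sub_neg_eq_add, mul_add, hdq, Real.cos_add_pi_div_two, neg_sq]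
  have hother : ∀ (x : Fin n → Bool) (b : Bool), A.outputProb x (!b) = 0 → A.outputProb x b = 1 := by
    intro x b h
    have := A.outputProb_add_outputProb x
    cases b <;> simp_all
  refine ⟨A, hAd, fun x b hb => ?_⟩
  rw [gFun] at hb
  rcases Nat.even_or_odd d with he | ho
  · simp only [he, decide_true] at hhalf hside
    have hs0 : Real.sin (d * (Real.pi / 2)) = 0 := by
      obtain ⟨j, rfl⟩ := he
      rw [← Real.sin_nat_mul_pi j]
      congr 1
      push_cast
      ring
    have hc1 : Real.cos (d * (Real.pi / 2)) ^ 2 = 1 := by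
      rw [Real.cos_sq', hs0]
      norm_num
    split_ifs at hb with h1 h2
    · obtain rfl := Option.some.inj hb
      exact hother x _ (by simpa [hs0] using hside x h1)
    · obtain rfl := Option.some.inj hb
      rw [hhalf x h2, hc1]
  · simp only [Nat.not_even_iff_odd.2 ho, decide_false] at hhalf hside
    have hc0 : Real.cos (d * (Real.pi / 2)) = 0 := by
      obtain ⟨j, rfl⟩ := ho
      rw [Real.cos_eq_zero_iff]
      exact ⟨j, by push_cast; ring⟩
    have hs1 : Real.sin (d * (Real.pi / 2)) ^ 2 = 1 := by
      rw [Real.sin_sq, hc0]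
      norm_num
    split_ifs at hb with h1 h2
    · obtain rfl := Option.some.inj hb
      rw [hside x h1, hs1]
    · obtain rfl := Option.some.inj hb
      exact hother x _ (by simpa [hc0] using hhalf x h2)

/-! ### Combining the bounds -/

lemma exactQuantumQueryComplexity_eq {n d : ℕ} {f : PartialBoolFun n}
    (hup : ∃ A : QuantumQueryAlgorithm n, A.queries = d ∧ A.ComputesExactly f)
    (hlow : ∀ A : QuantumQueryAlgorithm n, A.queries < d → ¬ A.ComputesExactly f) :
    exactQuantumQueryComplexity f = d := by
  obtain ⟨A, hd, hA⟩ := hup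
  refine le_antisymm ?_ (le_iInf₂ fun B hB => ?_)
  · rw [← hd]
    exact iInf₂_le A hA
  · exact_mod_cast not_lt.1 fun h => hlow B h hB

lemma not_computesExactly_of_queries_eq_zero {h k : ℕ} (hk : k < h)
    (A : QuantumQueryAlgorithm (2 * h)) (hA : A.queries = 0) :
    ¬ A.ComputesExactly (gFun (2 * h) k) := by
  intro hc
  obtain ⟨P, hP, -, hPh, hPk, -⟩ := exists_polynomial_of_computesExactly hk hc
  rw [Polynomial.eq_C_of_natDegree_le_zero (p := P) (by simpa [hA] using hP)] at hPh hPk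
  rw [Polynomial.eval_C] at hPh hPk
  linarith

lemma cos_mul_pi_div_two_mul {d : ℝ} (hd : d ≠ 0) :
    Real.cos ((d - 1) * Real.pi / (2 * d)) = Real.sin (Real.pi / (2 * d)) := by
  rw [← Real.cos_pi_div_two_sub]
  congr 1
  field_simp

theorem mainTheorem5 :
    (∀ n : ℕ, 0 < n → Even n → exactQuantumQueryComplexity (gFun n 0) = 1) ∧
    (∀ d : ℕ, 1 < d → ∀ κ₀ : ℝ,
      (1 / 2 : ℝ) * (1 - Real.cos (((d : ℝ) - 2) * Real.pi / (2 * ((d : ℝ) - 1)))) < κ₀ →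
      ∃ N : ℕ, ∀ n : ℕ, N ≤ n → Even n → ∀ k : ℕ,
        κ₀ ≤ (k : ℝ) / (n : ℝ) →
        (k : ℝ) / (n : ℝ) ≤
          (1 / 2 : ℝ) * (1 - Real.cos (((d : ℝ) - 1) * Real.pi / (2 * (d : ℝ)))) →
        exactQuantumQueryComplexity (gFun n k) = (d : ℕ∞)) := by
  refine ⟨fun n hn hev => ?_, fun d hd κ₀ hκ₀ => ?_⟩
  · obtain ⟨h, rfl⟩ := even_iff_two_dvd.1 hev
    refine exactQuantumQueryComplexity_eq (d := 1)
      (exists_computesExactly hn one_pos (by simp)) fun A hA => ?_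
    exact not_computesExactly_of_queries_eq_zero (by omega) A (by omega)
  · have hd1 : (1 : ℝ) < d := by exact_mod_cast hd
    have hcast : ((d - 1 : ℕ) : ℝ) = (d : ℝ) - 1 := by
      rw [Nat.cast_sub hd.le, Nat.cast_one]
    have hb : 1 - 2 * κ₀ < Real.sin (Real.pi / (2 * (d - 1 : ℕ))) := by
      rw [hcast, ← cos_mul_pi_div_two_mul (by linarith : (d : ℝ) - 1 ≠ 0)]
      have e : (d : ℝ) - 1 - 1 = d - 2 := by ring
      rw [e]
      linarith
    obtain ⟨N, hN⟩ := exists_forall_not_computesExactly (m := d - 1) (by omega) hb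
    -- With `n = 2h`, the extra `1` forces `h > 0` as well as `h ≥ N`.
    refine ⟨2 * N + 1, fun n hn hev k hk hk' => ?_⟩
    obtain ⟨h, rfl⟩ := even_iff_two_dvd.1 hev
    have hh0 : (0 : ℝ) < h := by exact_mod_cast (by omega : 0 < h)
    rw [cos_mul_pi_div_two_mul (by linarith : (d : ℝ) ≠ 0)] at hk'
    have hsin : 0 < Real.sin (Real.pi / (2 * d)) := by
      refine Real.sin_pos_of_pos_of_lt_pi (by positivity) ?_
      rw [div_lt_iff₀ (by positivity)]
      nlinarith [Real.pi_pos]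
    have hcast2 : ((2 * h : ℕ) : ℝ) = 2 * h := by push_cast; ring
    have hkh : 2 * ((k : ℝ) / (2 * h : ℕ)) = k / h := by
      rw [hcast2]
      field_simp
    have hlt : k < h := by
      have : (k : ℝ) / h < 1 := by linarith
      rw [div_lt_one hh0] at this
      exact_mod_cast this
    refine exactQuantumQueryComplexity_eq
      (exists_computesExactly (by omega) (by omega) (by rw [mul_div_assoc]; linarith))
      fun A hA => ?_
    exact hN h (by omega) k hlt (by linarith) A (by omega)
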